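/- Let $G$ be a finite simple connected $(q+1)$-regular graph with $n$ vertices and $m$ edges, and let $D_G$ be its symmetric digraph, which has the two arcs $(u,v)$ and $(v,u)$ for every edge $uv$ of $G$; write $o(e)=u$ and $t(e)=v$ for an arc $e=(u,v)$. An alternating walk of length $r$ from $v_0$ to $v_r$ is a sequence $[e_1,\dots,e_r]$ of arcs of $D_G$ that joins successive vertices $v_0,v_1,\dots,v_r$ and is traversed alternately along and against the direction of the arcs; that is, either $e_1=(v_0,v_1),\ e_2=(v_2,v_1),\ e_3=(v_2,v_3),\dots$ or $e_1=(v_1,v_0),\ e_2=(v_1,v_2),\ e_3=(v_3,v_2),\dots$. It is an alternating cycle if $r\ge 1$, $v_0=v_r=:v$, and $o(e_1)=o(e_r)=v$ or $t(e_1)=t(e_r)=v$. An alternating cycle is reduced if $e_{i+1}\ne e_i$ for $1\le i<r$ and $e_r\ne e_1$; it is prime if it is not obtained by going several times around a strictly shorter alternating cycle. Two alternating cycles are equivalent if one is a cyclic rotation of the other. The alternating zeta function of $G$ is $$\mathbf Z_a(G,t)=\prod_{[C]}\bigl(1-t^{|C|}\bigr)^{-1},$$ where $[C]$ runs over all equivalence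 classes of prime, reduced alternating cycles of $D_G$ and $|C|$ is the length of $C$. Let $\mathbf P$ be the $n\times n$ transition matrix of the simple random walk on $G$, i.e. $\mathbf P_{uv}=1/\deg u$ if $uv$ is an edge and $\mathbf P_{uv}=0$ otherwise, and let $\Delta=\mathbf D-\mathbf A$ be the Laplacian of $G$ (degree matrix minus adjacency matrix). Then, for every complex $t$ with $|t|<1$ and $q|t|<1$, the product defining $\mathbf Z_a(G,t)$ converges unconditionally to a non-zero value, and $$\begin{aligned}\mathbf Z_a(G,t)^{-1}&=(1-t^2)^{2(m-n)}\det\bigl((1+qt^2)\mathbf I_n-(q+1)t\,\mathbf P\bigr)\det\bigl((1+qt^2)\mathbf I_n+(q+1)t\,\mathbf P\bigr)\\&=(1-t^2)^{2(m-n)}\det\bigl((1-(q+1)t+qt^2)\mathbf I_n+t\Delta\bigr)\det\bigl((1+(q+1)t+qt^2)\mathbf I_n-t\Delta\bigr).\end{aligned}$$ -/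

import Mathlib

namespace SimpleGraph

variable {V : Type*} (G : SimpleGraph V)

/-- `G.IsAltWalk out u w [e₁, …, eᵣ]`: the arcs `e₁, …, eᵣ` of the symmetric digraph of `G` form an
alternating walk from `u` to `w`, i.e. they are traversed alternately along and against their
direction; the first one is traversed along its direction (the walk starts with an out-edge) if
`out = true`, and against it (the walk starts with an in-edge) if `out = false`. The arcs of the
symmetric digraph are the darts of `G`, with origin `e.fst` and terminus `e.snd`. -/
def IsAltWalk : Bool → V → V → List G.Dart → Prop
  | _, u, w, [] => u = w
  | true, u, w, e :: l => e.fst = u ∧ IsAltWalk false e.snd w l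
  | false, u, w, e :: l => e.snd = u ∧ IsAltWalk true e.fst w l

/-- An alternating cycle: a non-empty alternating walk from a vertex `v` to itself whose first and
last arcs both have origin `v` or both have terminus `v`. -/
def IsAltCycle (C : List G.Dart) : Prop :=
  ∃ (h : C ≠ []) (out : Bool) (v : V), G.IsAltWalk out v v C ∧
    (((C.head h).fst = v ∧ (C.getLast h).fst = v) ∨ ((C.head h).snd = v ∧ (C.getLast h).snd = v))

/-- A reduced alternating cycle: no backtracking (no two consecutive arcs are equal) and no tail
(the last arc differs from the first one). -/
def IsReducedAltCycle (C : List G.Dart) : Prop :=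
  G.IsAltCycle C ∧ C.IsChain (· ≠ ·) ∧ C.getLast? ≠ C.head?

/-- A prime alternating cycle: one that is not a multiple of a strictly smaller one. -/
def IsPrimeAltCycle (C : List G.Dart) : Prop :=
  G.IsAltCycle C ∧
    ¬ ∃ (B : List G.Dart) (r : ℕ), G.IsAltCycle B ∧ B.length < C.length ∧
      C = (List.replicate r B).flatten

/-- The prime, reduced alternating cycles. -/
def PrimeReducedAltCycle : Type _ :=
  {C : List G.Dart // G.IsPrimeAltCycle C ∧ G.IsReducedAltCycle C}

/-- Two cycles are equivalent if one is a cyclic rotation of the other. -/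
def altCycleSetoid : Setoid G.PrimeReducedAltCycle :=
  (List.IsRotated.setoid G.Dart).comap Subtype.val

/-- The equivalence classes `[C]` of prime, reduced alternating cycles. -/
def AltCycleClass : Type _ := Quotient G.altCycleSetoid

/-- The length `|C|` of an equivalence class `[C]`. -/
def AltCycleClass.length {G : SimpleGraph V} (c : G.AltCycleClass) : ℕ :=
  Quotient.lift (s := G.altCycleSetoid) (fun C => C.val.length) (fun _ _ h => h.perm.length_eq) c

/-- The alternating zeta function of `G` as an Euler product. -/
noncomputable def altZeta (t : ℂ) : ℂ := ∏' c : G.AltCycleClass, (1 - t ^ c.length)⁻¹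

/-- The transition probability matrix of the simple random walk on `G`. -/
noncomputable def transitionMatrix [Fintype V] [DecidableRel G.Adj] : Matrix V V ℂ :=
  Matrix.of fun u v => if G.Adj u v then 1 / (G.degree u : ℂ) else 0

end SimpleGraph

/-! A state is an arc together with the direction in which it is traversed. A reduced alternating
walk is a path of the relation `AltStep` on states. If T is the 0-1 matrix of this relation, tr T^k
counts the closed paths of length k.

Every closed path is a primitive periodic path run through a unique number of times. A prime reduced
alternating cycle is the same thing as a primitive periodic path of states, and a class of length ℓ
consists of exactly ℓ of them, its rotations. Hence the sum of tr((tT)^k)/k over k ≥ 1 equals the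
sum of -log(1 - t^|C|) over classes. By `det_one_sub_eq_exp_neg_tsum` the Euler product is therefore
1/det(1 - tT). Each state has q successors, so q|t| < 1 gives absolute convergence; being an
exponential, the value is not zero (`exists_hasProd_altZeta`).

It remains to shrink the determinant from states to vertices, as in Bass' formula. In block form T =
XY - J, where J exchanges the two directions and X, Y are built from the arc-vertex incidence
matrices. Factoring out 1 + tJ and using det(1 - MN) = det(1 - NM) leaves a matrix of size 2n with
blocks (1 + qt²)I and -tA. Its determinant splits into the two factors with -tA and +tA
(`det_one_sub_smul_altBlockMatrix`). Regularity turns A into (q+1)P or (q+1)I - Δ. -/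

namespace Matrix

/-! ### The logarithm of a determinant as a trace series -/

section LogDet

attribute [local instance] Matrix.linftyOpNormedRing Matrix.linftyOpNormedAlgebra

variable {n : Type*} [Fintype n] [DecidableEq n]

lemma hasDerivAt_det_one_add_smul (M : Matrix n n ℂ) :
    HasDerivAt (fun z : ℂ => (1 + z • M).det) M.trace 0 := by
  set P : Polynomial ℂ := (1 + (Polynomial.X : Polynomial ℂ) • M.map Polynomial.C).det with hP
  have h : ∀ z : ℂ, (1 + z • M).det = P.eval z := by
    intro z
    rw [hP, ← Polynomial.coe_evalRingHom, RingHom.map_det]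
    congr 1
    ext i j
    by_cases hij : i = j <;> simp [hij, mul_comm z]
  have := P.hasDerivAt 0
  rw [hP, derivative_det_one_add_X_smul] at this
  simpa only [h] using this

/-- Jacobi's formula for the derivative of `det (1 - z A)`. -/
lemma hasDerivAt_det_one_sub_smul (A B : Matrix n n ℂ) (z : ℂ) (hB : (1 - z • A) * B = 1) :
    HasDerivAt (fun w : ℂ => (1 - w • A).det) (-(1 - z • A).det * (B * A).trace) z := by
  have h := (hasDerivAt_det_one_add_smul (-(B * A))).const_mul (1 - z • A).det
  have h' : HasDerivAt (fun w : ℂ => w - z) 1 z := (hasDerivAt_id z).sub_const z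
  rw [← sub_self z] at h
  have h2 := HasDerivAt.comp (h₂ := fun y => (1 - z • A).det * (1 + y • -(B * A)).det)
    (h := fun w : ℂ => w - z) z h h'
  -- As B inverts 1 - zA, one has 1 - wA = (1 - zA)(1 - (w - z)BA), which moves the derivative at z
  -- to one at 0.
  have he : (fun w : ℂ => (1 - w • A).det) =
      (fun y => (1 - z • A).det * (1 + y • -(B * A)).det) ∘ fun w : ℂ => w - z := by
    funext w
    simp only [Function.comp]
    rw [← det_mul]
    congr 1
    rw [mul_add, Matrix.mul_smul, mul_neg, ← mul_assoc, hB]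
    simp only [mul_one, one_mul]
    module
  rw [he]
  simpa using h2

lemma norm_trace_le_card_mul_norm (M : Matrix n n ℂ) : ‖M.trace‖ ≤ Fintype.card n * ‖M‖ := by
  rw [trace]
  refine (norm_sum_le _ _).trans ?_
  refine (Finset.sum_le_card_nsmul _ _ ‖M‖ fun i _ => ?_).trans (by simp)
  rw [linfty_opNorm_def]
  have h1 : ‖M i i‖₊ ≤ ∑ j, ‖M i j‖₊ :=
    Finset.single_le_sum (f := fun j => ‖M i j‖₊) (fun _ _ => zero_le) (Finset.mem_univ i)
  exact_mod_cast h1.trans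
    (Finset.le_sup (f := fun i => ∑ j, ‖M i j‖₊) (Finset.mem_univ i))

lemma linfty_opNorm_le_of_row_sum_le {A : Matrix n n ℂ} {c : ℝ} (hc : 0 ≤ c)
    (hA : ∀ i, ∑ j, ‖A i j‖ ≤ c) : ‖A‖ ≤ c := by
  rw [linfty_opNorm_def]
  lift c to NNReal using hc
  norm_cast
  refine Finset.sup_le fun i _ => ?_
  have := hA i
  rw [← NNReal.coe_le_coe]
  simpa using this

/-- Row sums control a submultiplicative norm. This geometric bound drives every convergence
argument below. -/
lemma norm_trace_pow_succ_le {A : Matrix n n ℂ} {c : ℝ} (hc : 0 ≤ c)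
    (hA : ∀ i, ∑ j, ‖A i j‖ ≤ c) (k : ℕ) :
    ‖(A ^ (k + 1)).trace‖ ≤ Fintype.card n * c ^ (k + 1) := by
  refine (norm_trace_le_card_mul_norm _).trans ?_
  gcongr
  refine (norm_pow_le' A k.succ_pos).trans ?_
  gcongr
  exact linfty_opNorm_le_of_row_sum_le hc hA

/-- `log det (1 - A) = tr log (1 - A)` for a matrix whose row sums are less than one. -/
theorem det_one_sub_eq_exp_neg_tsum {A : Matrix n n ℂ} {c : ℝ} (hc : 0 ≤ c) (hc1 : c < 1)
    (hA : ∀ i, ∑ j, ‖A i j‖ ≤ c) :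
    (1 - A).det = Complex.exp (-∑' k : ℕ, (A ^ (k + 1)).trace / ((k : ℂ) + 1)) := by
  -- The open ball of radius R must contain the point 1 while the series still converges on it.
  obtain ⟨R, hR1, hcR⟩ : ∃ R : ℝ, 1 < R ∧ R * c < 1 := by
    refine ⟨2 / (1 + c), ?_, ?_⟩
    · rw [lt_div_iff₀ (by linarith)]; linarith
    · rw [div_mul_eq_mul_div, div_lt_one (by linarith)]; linarith
  have hR0 : 0 < R := by linarith
  have hnA : ‖A‖ ≤ c := linfty_opNorm_le_of_row_sum_le hc hA
  set U : Set ℂ := Metric.ball 0 R with hU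
  have hzA : ∀ z ∈ U, ‖z • A‖ < 1 := by
    intro z hz
    rw [hU, mem_ball_zero_iff] at hz
    rw [norm_smul]
    calc ‖z‖ * ‖A‖ ≤ R * c := by gcongr
      _ < 1 := hcR
  set g : ℕ → ℂ → ℂ := fun k z => z ^ (k + 1) * ((A ^ (k + 1)).trace / ((k : ℂ) + 1))
  set g' : ℕ → ℂ → ℂ := fun k z => z ^ k * (A ^ (k + 1)).trace
  have hg : ∀ k, ∀ y ∈ U, HasDerivAt (g k) (g' k y) y := by
    intro k y _
    have h := (hasDerivAt_pow (k + 1) y).mul_const ((A ^ (k + 1)).trace / ((k : ℂ) + 1))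
    refine h.congr_deriv ?_
    have : (k : ℂ) + 1 ≠ 0 := by exact_mod_cast k.succ_ne_zero
    simp only [g', add_tsub_cancel_right]
    push_cast
    field_simp
  have hu : Summable fun k : ℕ => (Fintype.card n * c) * (R * c) ^ k :=
    (summable_geometric_of_lt_one (by positivity) hcR).mul_left _
  have hg' : ∀ k, ∀ y ∈ U, ‖g' k y‖ ≤ (Fintype.card n * c) * (R * c) ^ k := by
    intro k y hy
    rw [hU, mem_ball_zero_iff] at hy
    simp only [g', norm_mul, norm_pow]
    calc ‖y‖ ^ k * ‖(A ^ (k + 1)).trace‖ ≤ R ^ k * (Fintype.card n * c ^ (k + 1)) := by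
          gcongr
          exact norm_trace_pow_succ_le hc hA k
      _ = _ := by ring
  have h0U : (0 : ℂ) ∈ U := Metric.mem_ball_self hR0
  have hpre : IsPreconnected U := (convex_ball (0 : ℂ) R).isPreconnected
  have hsum := fun z (hz : z ∈ U) => hasDerivAt_tsum_of_isPreconnected hu Metric.isOpen_ball hpre hg hg'
    h0U (by simp [g]) hz
  have htr : ∀ z ∈ U, ∃ B : Matrix n n ℂ, (1 - z • A) * B = 1 ∧
      ∑' k, g' k z = (B * A).trace := by
    intro z hz
    refine ⟨∑' k : ℕ, (z • A) ^ k, mul_neg_geom_series _ (hzA z hz), ?_⟩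
    have hs : HasSum (fun k : ℕ => (z • A) ^ k) (∑' k : ℕ, (z • A) ^ k) :=
      (summable_geometric_of_norm_lt_one (hzA z hz)).hasSum
    have hs2 := (hs.mul_right A).map (traceAddMonoidHom n ℂ) (by
      show Continuous fun M : Matrix n n ℂ => M.trace
      exact continuous_id.matrix_trace)
    refine HasSum.tsum_eq ?_
    have he : (fun k => g' k z) = traceAddMonoidHom n ℂ ∘ fun k : ℕ => (z • A) ^ k * A := by
      funext k
      simp [g', smul_pow, pow_succ]
    rw [he]
    exact hs2
  -- By Jacobi's formula the two logarithmic derivatives cancel, so F is constant on the ball;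
  -- comparing z = 1 with z = 0 avoids any branch of the logarithm.
  set F : ℂ → ℂ := fun z => (1 - z • A).det * Complex.exp (∑' k, g k z)
  have hF : ∀ z ∈ U, HasDerivAt F 0 z := by
    intro z hz
    obtain ⟨B, hB, htB⟩ := htr z hz
    have h1 := (hasDerivAt_det_one_sub_smul A B z hB).mul (hsum z hz).cexp
    rw [htB] at h1
    exact h1.congr_deriv (by ring)
  have h1U : (1 : ℂ) ∈ U := by simpa [hU] using hR1
  have hconst : F 1 = F 0 :=
    Metric.isOpen_ball.is_const_of_deriv_eq_zero hpre
      (fun z hz => (hF z hz).differentiableAt.differentiableWithinAt)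
      (fun z hz => (hF z hz).deriv) h1U h0U
  simp only [F, g, one_smul, one_pow, one_mul, zero_smul, sub_zero, det_one, ne_eq,
    Nat.add_eq_zero_iff, one_ne_zero, and_false, not_false_eq_true, zero_pow, zero_mul, tsum_zero,
    Complex.exp_zero] at hconst
  rw [Complex.exp_neg]
  exact eq_inv_of_mul_eq_one_left hconst

end LogDet

end Matrix

/-! ### The determinant formula of Bass type -/

namespace Matrix

variable {n : Type*} [Fintype n] [DecidableEq n] {R : Type*} [CommRing R]

/-- Multiplying by unipotent block matrices on both sides makes the matrix block triangular; A and B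
need not commute. -/
lemma det_fromBlocks_comm_symm (A B : Matrix n n R) :
    (fromBlocks A B B A).det = (A + B).det * (A - B).det := by
  have h : fromBlocks (1 : Matrix n n R) 1 0 1 * fromBlocks A B B A *
      fromBlocks 1 (-1) 0 1 = fromBlocks (A + B) 0 B (A - B) := by
    simp only [fromBlocks_multiply]
    congr 1 <;> simp <;> abel
  have h2 := congrArg det h
  simpa [det_mul, det_fromBlocks_zero₂₁, det_fromBlocks_zero₁₂] using h2

end Matrix

namespace SimpleGraph

open Matrix

variable {V : Type*} [Fintype V] [DecidableEq V] (G : SimpleGraph V) [DecidableRel G.Adj]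

/-- The incidence matrix of arcs and origins. -/
def originMatrix : Matrix G.Dart V ℂ := of fun e v => if e.fst = v then 1 else 0

/-- The incidence matrix of arcs and termini. -/
def terminusMatrix : Matrix G.Dart V ℂ := of fun e v => if e.snd = v then 1 else 0

lemma card_dart_snd_eq (v : V) :
    (Finset.univ.filter fun e : G.Dart => e.snd = v).card = G.degree v := by
  rw [← dart_fst_fiber_card_eq_degree]
  refine Finset.card_bij' (fun e _ => e.symm) (fun e _ => e.symm) ?_ ?_ ?_ ?_ <;> simp

lemma card_dart_fst_snd_eq (u v : V) :
    (Finset.univ.filter fun e : G.Dart => e.fst = u ∧ e.snd = v).card =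
      if G.Adj u v then 1 else 0 := by
  split_ifs with h
  · rw [Finset.card_eq_one]
    refine ⟨⟨(u, v), h⟩, ?_⟩
    ext e
    simp only [Finset.mem_filter, Finset.mem_univ, true_and, Finset.mem_singleton]
    rw [Dart.ext_iff, Prod.ext_iff]
  · rw [Finset.card_eq_zero, Finset.filter_eq_empty_iff]
    rintro e - ⟨rfl, rfl⟩
    exact h e.adj

lemma transpose_originMatrix_mul_self (d : ℂ) (hd : ∀ v, (G.degree v : ℂ) = d) :
    G.originMatrixᵀ * G.originMatrix = d • (1 : Matrix V V ℂ) := by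
  ext u v
  simp only [mul_apply, transpose_apply, originMatrix, of_apply, mul_ite, mul_one, mul_zero,
    Matrix.smul_apply, one_apply, smul_eq_mul]
  by_cases h : u = v
  · subst h
    rw [if_pos rfl, ← hd u, ← dart_fst_fiber_card_eq_degree,
      Finset.natCast_card_filter]
    exact Finset.sum_congr rfl fun e _ => by split_ifs <;> rfl
  · rw [if_neg h]
    refine Finset.sum_eq_zero fun e _ => ?_
    split_ifs with h1 h2 <;> simp_all

lemma transpose_terminusMatrix_mul_self (d : ℂ) (hd : ∀ v, (G.degree v : ℂ) = d) :
    G.terminusMatrixᵀ * G.terminusMatrix = d • (1 : Matrix V V ℂ) := by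
  ext u v
  simp only [mul_apply, transpose_apply, terminusMatrix, of_apply, mul_ite, mul_one, mul_zero,
    Matrix.smul_apply, one_apply, smul_eq_mul]
  by_cases h : u = v
  · subst h
    rw [if_pos rfl, ← hd u, ← card_dart_snd_eq, Finset.natCast_card_filter]
    exact Finset.sum_congr rfl fun e _ => by split_ifs <;> rfl
  · rw [if_neg h]
    refine Finset.sum_eq_zero fun e _ => ?_
    split_ifs with h1 h2 <;> simp_all

lemma transpose_originMatrix_mul_terminusMatrix :
    G.originMatrixᵀ * G.terminusMatrix = G.adjMatrix ℂ := by
  ext u v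
  simp only [mul_apply, transpose_apply, terminusMatrix, originMatrix, of_apply, adjMatrix_apply]
  have := congrArg (Nat.cast (R := ℂ)) (G.card_dart_fst_snd_eq u v)
  rw [Finset.natCast_card_filter] at this
  push_cast at this
  rw [← this]
  refine Finset.sum_congr rfl fun e _ => ?_
  by_cases h1 : e.fst = u <;> by_cases h2 : e.snd = v <;> simp [h1, h2]

lemma transpose_terminusMatrix_mul_originMatrix :
    G.terminusMatrixᵀ * G.originMatrix = G.adjMatrix ℂ := by
  have := congrArg transpose G.transpose_originMatrix_mul_terminusMatrix
  simpa [transpose_mul] using this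

/-- The transfer matrix of reduced alternating walks, in block form. -/
noncomputable def altBlockMatrix : Matrix (G.Dart ⊕ G.Dart) (G.Dart ⊕ G.Dart) ℂ :=
  fromBlocks 0 (G.terminusMatrix * G.terminusMatrixᵀ - 1)
    (G.originMatrix * G.originMatrixᵀ - 1) 0

/-- The analogue of Bass' determinant formula for alternating walks. -/
theorem det_one_sub_smul_altBlockMatrix (q t : ℂ) (hq : ∀ v, (G.degree v : ℂ) = q + 1)
    (ht : 1 - t ^ 2 ≠ 0) :
    (1 - t • G.altBlockMatrix).det * (1 - t ^ 2) ^ (2 * Fintype.card V) =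
      (1 - t ^ 2) ^ Fintype.card G.Dart *
        (((1 + q * t ^ 2) • (1 : Matrix V V ℂ) - t • G.adjMatrix ℂ).det *
        ((1 + q * t ^ 2) • (1 : Matrix V V ℂ) + t • G.adjMatrix ℂ).det) := by
  set H := G.terminusMatrix
  set O := G.originMatrix
  set D : Matrix (G.Dart ⊕ G.Dart) (G.Dart ⊕ G.Dart) ℂ := fromBlocks 1 (t • 1) (t • 1) 1 with hD
  set D' : Matrix (G.Dart ⊕ G.Dart) (G.Dart ⊕ G.Dart) ℂ :=
    fromBlocks 1 (-(t • 1)) (-(t • 1)) 1 with hD'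
  set X : Matrix (G.Dart ⊕ G.Dart) (V ⊕ V) ℂ := fromBlocks H 0 0 O with hX
  set Y : Matrix (V ⊕ V) (G.Dart ⊕ G.Dart) ℂ := fromBlocks 0 Hᵀ Oᵀ 0 with hY
  set s : ℂ := (1 - t ^ 2)⁻¹ with hs
  have hDD' : D * D' = (1 - t ^ 2) • 1 := by
    rw [hD, hD', fromBlocks_multiply, ← fromBlocks_one, fromBlocks_smul]
    congr 1 <;> simp <;> module
  have hdetD : D.det = (1 - t ^ 2) ^ Fintype.card G.Dart := by
    rw [hD, det_fromBlocks_comm_symm]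
    have h1 : (1 : Matrix G.Dart G.Dart ℂ) + t • 1 = (1 + t) • 1 := by module
    have h2 : (1 : Matrix G.Dart G.Dart ℂ) - t • 1 = (1 - t) • 1 := by module
    rw [h1, h2, det_smul, det_smul, det_one, mul_one, mul_one, ← mul_pow]
    ring
  -- The left side is D - tXY, and the inverse of D is sD'.
  have hfac : 1 - t • G.altBlockMatrix = D * (1 - ((s * t) • (D' * X)) * Y) := by
    rw [mul_sub, mul_one, Matrix.smul_mul, Matrix.mul_smul, ← Matrix.mul_assoc,
      ← Matrix.mul_assoc, hDD', Matrix.smul_mul, Matrix.smul_mul, Matrix.one_mul, smul_smul, show s * t * (1 - t ^ 2) = t by rw [hs]; field_simp]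
    rw [hD, hX, hY, altBlockMatrix, fromBlocks_multiply, ← fromBlocks_one, fromBlocks_smul,
      fromBlocks_smul, sub_eq_add_neg, sub_eq_add_neg (fromBlocks _ (t • 1) _ _), fromBlocks_neg,
      fromBlocks_neg, fromBlocks_add, fromBlocks_add]
    congr 1 <;> simp [H, O, sub_eq_add_neg]
  have hYD'X : Y * (D' * X) = fromBlocks (-((t * (q + 1)) • 1)) (G.adjMatrix ℂ) (G.adjMatrix ℂ)
      (-((t * (q + 1)) • 1)) := by
    rw [hX, hY, hD', fromBlocks_multiply, fromBlocks_multiply]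
    have h1 := G.transpose_terminusMatrix_mul_self _ hq
    have h2 := G.transpose_originMatrix_mul_self _ hq
    have h3 := G.transpose_originMatrix_mul_terminusMatrix
    have h4 := G.transpose_terminusMatrix_mul_originMatrix
    simp only [H, O]
    congr 1 <;> simp [h1, h2, h3, h4, smul_smul]
  -- The diagonal entry is (1 - t²) + t²(q + 1) = 1 + qt².
  have hsmall : (1 - t ^ 2) • (1 - Y * ((s * t) • (D' * X))) =
      fromBlocks ((1 + q * t ^ 2) • 1) (-(t • G.adjMatrix ℂ)) (-(t • G.adjMatrix ℂ))
        ((1 + q * t ^ 2) • 1) := by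
    rw [Matrix.mul_smul, hYD'X, smul_sub, smul_smul,
      show (1 - t ^ 2) * (s * t) = t by rw [hs]; field_simp]
    rw [← fromBlocks_one, fromBlocks_smul, fromBlocks_smul, sub_eq_add_neg, fromBlocks_neg,
      fromBlocks_add]
    congr 1
    · module
    · simp
    · simp
    · module
  have hdet := congrArg det hsmall
  rw [det_smul, det_fromBlocks_comm_symm, Fintype.card_sum, ← two_mul] at hdet
  rw [hfac, det_mul, det_one_sub_mul_comm, hdetD, mul_assoc, mul_comm _ (_ ^ (2 * _)), hdet,
    ← sub_eq_add_neg, sub_neg_eq_add]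

end SimpleGraph

/-! ### Closed paths of a relation and traces of matrix powers -/

open Function

/-- The one-sided shift. -/
def seqShift {S : Type*} (x : ℕ → S) : ℕ → S := fun i => x (i + 1)

lemma seqShift_iterate_apply {S : Type*} (k : ℕ) (x : ℕ → S) (i : ℕ) :
    seqShift^[k] x i = x (i + k) := by
  induction k generalizing x with
  | zero => rfl
  | succ k ih => rw [iterate_succ_apply, ih, seqShift, add_assoc]

lemma isPeriodicPt_seqShift_iff {S : Type*} {k : ℕ} {x : ℕ → S} :
    IsPeriodicPt seqShift k x ↔ Function.Periodic x k := by
  rw [IsPeriodicPt, IsFixedPt, funext_iff]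
  simp only [seqShift_iterate_apply, Function.Periodic]

/-- The sequences that follow the relation `r` and have period `k`. -/
def ClosedPath {S : Type*} (r : S → S → Prop) (k : ℕ) : Type _ :=
  {x : ℕ → S // (∀ i, r (x i) (x (i + 1))) ∧ IsPeriodicPt seqShift k x}

/-- The periodic sequences that follow the relation `r`. -/
def PeriodicPath {S : Type*} (r : S → S → Prop) : Type _ :=
  {x : ℕ → S // (∀ i, r (x i) (x (i + 1))) ∧ x ∈ periodicPts seqShift}

/-- The minimal period of a periodic path. -/
noncomputable def PeriodicPath.period {S : Type*} {r : S → S → Prop} (x : PeriodicPath r) : ℕ :=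
  minimalPeriod seqShift x.1

lemma PeriodicPath.period_pos {S : Type*} {r : S → S → Prop} (x : PeriodicPath r) :
    0 < x.period :=
  minimalPeriod_pos_of_mem_periodicPts x.2.2

section Count

variable {S : Type*} [Fintype S] [DecidableEq S]

/-- The entries of the powers of a matrix as sums over paths. -/
lemma Matrix.pow_apply_eq_sum_paths {R : Type*} [CommSemiring R] (T : Matrix S S R) (k : ℕ)
    (a b : S) :
    (T ^ k) a b = ∑ w : Fin (k + 1) → S, if w 0 = a ∧ w (Fin.last k) = b then
      ∏ i : Fin k, T (w i.castSucc) (w i.succ) else 0 := by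
  induction k generalizing a b with
  | zero =>
    rw [← (Equiv.funUnique (Fin 1) S).symm.sum_comp]
    simp only [pow_zero, Matrix.one_apply, Finset.univ_eq_empty, Finset.prod_empty]
    by_cases h : a = b
    · subst h; simp
    · rw [if_neg h]
      symm
      refine Finset.sum_eq_zero fun s _ => ?_
      rw [if_neg]
      rintro ⟨h1, h2⟩
      exact h (h1.symm.trans h2)
  | succ k ih =>
    rw [← (Fin.consEquiv fun _ : Fin (k + 2) => S).sum_comp, Fintype.sum_prod_type, pow_succ',
      Matrix.mul_apply]
    simp only [Fin.consEquiv_apply, Fin.cons_zero, ← Fin.succ_last, Fin.cons_succ,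
      Fin.prod_univ_succ, Fin.castSucc_zero, ← Fin.succ_castSucc]
    symm
    rw [Finset.sum_eq_single a]
    · simp only [ih, Finset.mul_sum]
      symm
      rw [Finset.sum_comm]
      refine Finset.sum_congr rfl fun w _ => ?_
      rw [Finset.sum_eq_single (w 0)]
      · simp
      · intro c _ hc
        rw [if_neg (fun h => hc h.1.symm), mul_zero]
      · simp
    · intro c _ hc
      exact Finset.sum_eq_zero fun w _ => if_neg fun h => hc h.1
    · simp

/-- The 0-1-matrix of a relation. -/
def relMatrix (r : S → S → Prop) [DecidableRel r] : Matrix S S ℂ :=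
  Matrix.of fun a b => if r a b then 1 else 0

variable (r : S → S → Prop)

/-- Closed paths of length `k`, recorded by a full period. -/
def closedPathEquiv (k : ℕ) (hk : 0 < k) : ClosedPath r k ≃
    {w : Fin (k + 1) → S // w 0 = w (Fin.last k) ∧ ∀ i : Fin k, r (w i.castSucc) (w i.succ)} where
  toFun x := ⟨fun i => x.1 i, by
    have h := isPeriodicPt_seqShift_iff.1 x.2.2
    refine ⟨?_, fun i => x.2.1 i⟩
    simpa using (h 0).symm⟩
  invFun w := ⟨fun i => w.1 ⟨i % k, (Nat.mod_lt i hk).trans k.lt_succ_self⟩, by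
    refine ⟨fun i => ?_, isPeriodicPt_seqShift_iff.2 fun i => by simp⟩
    have h := w.2.2 ⟨i % k, Nat.mod_lt i hk⟩
    have hi := Nat.mod_lt i hk
    refine Eq.subst (motive := r _) ?_ h
    symm
    rcases Nat.lt_or_ge (i % k + 1) k with h1 | h1
    · refine congrArg w.1 (Fin.ext ?_)
      simp only [Fin.val_succ]
      rw [Nat.add_mod, Nat.mod_eq_of_lt (a := 1) (by omega), Nat.mod_eq_of_lt h1]
    -- At the wrap-around the step leads to the last entry of `w`, which agrees with `w 0`.
    · have h2 : i % k + 1 = k := by omega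
      have h3 : (i + 1) % k = 0 := by
        rw [← Nat.mod_add_mod, h2, Nat.mod_self]
      have h4 : (⟨(i + 1) % k, (Nat.mod_lt (i + 1) hk).trans k.lt_succ_self⟩ : Fin (k + 1)) = 0 :=
        Fin.ext h3
      simp only [h4, w.2.1]
      exact congrArg w.1 (Fin.ext (by simp [h2]))⟩
  left_inv x := by
    apply Subtype.ext
    funext i
    have h := isPeriodicPt_seqShift_iff.1 x.2.2
    exact h.map_mod_nat i
  right_inv w := by
    apply Subtype.ext
    funext i
    rcases Nat.lt_or_ge i k with h | h
    · simp only [Nat.mod_eq_of_lt h]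
    · have h1 : i = Fin.last k := Fin.ext (by have := i.2; simp; omega)
      subst h1
      simp only [Fin.val_last, Nat.mod_self]
      exact w.2.1

lemma trace_relMatrix_pow [DecidableRel r] (k : ℕ) (hk : 0 < k) :
    (relMatrix r ^ k).trace = Nat.card (ClosedPath r k) := by
  rw [Nat.card_congr (closedPathEquiv r k hk), Nat.card_eq_fintype_card, Fintype.card_subtype,
    Finset.natCast_card_filter, Matrix.trace]
  simp only [Matrix.diag_apply, Matrix.pow_apply_eq_sum_paths]
  rw [Finset.sum_comm]
  refine Finset.sum_congr rfl fun w _ => ?_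
  have h : ∀ a, (w 0 = a ∧ w (Fin.last k) = a) ↔ (a = w 0 ∧ w 0 = w (Fin.last k)) := by
    intro a
    constructor
    · rintro ⟨rfl, h⟩; exact ⟨rfl, h.symm⟩
    · rintro ⟨rfl, h⟩; exact ⟨rfl, h.symm⟩
  simp only [h, ite_and, Finset.sum_ite_eq', Finset.mem_univ, if_true]
  simp only [relMatrix, Matrix.of_apply, Finset.prod_ite_zero, Finset.prod_const_one,
    Finset.mem_univ, true_imp_iff]

end Count

/-! ### Closed paths as repetitions of primitive ones -/

section Sum

variable {S : Type*} {r : S → S → Prop}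

/-- A closed path is a periodic path traversed a number of times. -/
noncomputable def repeatPath (y : Σ _ : PeriodicPath r, ℕ) : Σ k : ℕ, ClosedPath r (k + 1) :=
  ⟨(y.2 + 1) * y.1.period - 1, y.1.1, y.1.2.1, by
    rw [Nat.sub_add_cancel (Nat.mul_pos y.2.succ_pos y.1.period_pos)]
    exact (isPeriodicPt_minimalPeriod _ _).const_mul _⟩

lemma repeatPath_fst_add_one (y : Σ _ : PeriodicPath r, ℕ) :
    (repeatPath y).1 + 1 = (y.2 + 1) * y.1.period :=
  Nat.sub_add_cancel (Nat.mul_pos y.2.succ_pos y.1.period_pos)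

/-- The minimal period divides every period, so the sequence and the multiplicity determine each
other's data uniquely. -/
lemma repeatPath_bijective : Bijective (repeatPath (r := r)) := by
  constructor
  · rintro ⟨x, j⟩ ⟨x', j'⟩ h
    have h1 : x.1 = x'.1 := congrArg (fun y : Σ k : ℕ, ClosedPath r (k + 1) => y.2.1) h
    have h2 : x = x' := Subtype.ext h1
    subst h2
    have h3 := congrArg (fun y : Σ k : ℕ, ClosedPath r (k + 1) => y.1 + 1) h
    simp only [repeatPath_fst_add_one] at h3
    have := Nat.eq_of_mul_eq_mul_right x.period_pos h3
    simp only [Nat.add_right_cancel_iff] at this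
    rw [this]
  · rintro ⟨k, x, hx, hk⟩
    set y : PeriodicPath r := ⟨x, hx, mk_mem_periodicPts k.succ_pos hk⟩ with hy
    obtain ⟨j, hj⟩ := hk.minimalPeriod_dvd
    have hj' : k + 1 = y.period * j := hj
    obtain ⟨j, rfl⟩ : ∃ i, j = i + 1 := ⟨j - 1, by
      rcases Nat.eq_zero_or_pos j with h | h
      · subst h; simp at hj'
      · omega⟩
    have hk' : (repeatPath ⟨y, j⟩).1 = k := by
      have := repeatPath_fst_add_one ⟨y, j⟩
      rw [mul_comm, ← hj'] at this
      omega
    refine ⟨⟨y, j⟩, ?_⟩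
    generalize hz : repeatPath ⟨y, j⟩ = z at hk'
    have hz2 : z.2.1 = x := by rw [← hz]; rfl
    obtain ⟨k', z⟩ := z
    subst hk'
    exact congrArg _ (Subtype.ext hz2)

lemma finite_closedPath [Finite S] (k : ℕ) (hk : 0 < k) : Finite (ClosedPath r k) :=
  Finite.of_equiv _ (closedPathEquiv r k hk).symm

/-- The family t^k/k over all closed paths of length k is summed in two ways: by length it yields
traces, hence the determinant; by underlying primitive path it yields logarithms. Dividing by the
period compensates for counting each cyclic rotation separately. -/
theorem exists_hasSum_neg_log_periodicPath [Fintype S] [DecidableEq S] [DecidableRel r] (Q : ℕ)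
    (hQ : ∀ a, (Finset.univ.filter (r a)).card ≤ Q) (t : ℂ) (ht : ‖t‖ < 1)
    (hQt : (Q : ℝ) * ‖t‖ < 1) :
    ∃ L : ℂ, HasSum (fun x : PeriodicPath r => -Complex.log (1 - t ^ x.period) / x.period) L ∧
      Complex.exp (-L) = (1 - t • relMatrix r).det := by
  have hrow : ∀ i, ∑ j, ‖(t • relMatrix r) i j‖ ≤ Q * ‖t‖ := by
    intro i
    have h : ∀ j, ‖(t • relMatrix r) i j‖ = (if r i j then 1 else 0) * ‖t‖ := by
      intro j
      simp only [relMatrix, Matrix.smul_apply, Matrix.of_apply, smul_eq_mul, norm_mul]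
      split_ifs <;> simp
    simp only [h, ← Finset.sum_mul, Finset.sum_boole]
    gcongr
    exact_mod_cast hQ i
  have hc : 0 ≤ (Q : ℝ) * ‖t‖ := by positivity
  have htr : ∀ k : ℕ, ((t • relMatrix r) ^ (k + 1)).trace =
      Nat.card (ClosedPath r (k + 1)) * t ^ (k + 1) := by
    intro k
    rw [smul_pow, Matrix.trace_smul, trace_relMatrix_pow _ _ k.succ_pos, smul_eq_mul, mul_comm]
  set f : (Σ k : ℕ, ClosedPath r (k + 1)) → ℂ := fun y => t ^ (y.1 + 1) / ((y.1 : ℂ) + 1) with hf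
  have hnorm : ∀ k : ℕ, ‖((k : ℂ) + 1)‖ = (k : ℝ) + 1 := by
    intro k
    exact_mod_cast Complex.norm_natCast (k + 1)
  have hfs : Summable f := by
    refine Summable.of_norm ?_
    rw [summable_sigma_of_nonneg fun _ => norm_nonneg _]
    refine ⟨fun k => ?_, ?_⟩
    · have := finite_closedPath (r := r) (k + 1) k.succ_pos
      exact Summable.of_finite
    · refine Summable.of_nonneg_of_le (fun k => tsum_nonneg fun _ => norm_nonneg _) (fun k => ?_)
        ((summable_nat_add_iff 1).2 ((summable_geometric_of_lt_one hc hQt).mul_left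
          (Fintype.card S : ℝ)))
      have := finite_closedPath (r := r) (k + 1) k.succ_pos
      have hb := Matrix.norm_trace_pow_succ_le hc hrow k
      rw [htr, norm_mul, Complex.norm_natCast, norm_pow] at hb
      simp only [hf, norm_div, norm_pow, hnorm]
      rw [tsum_const, nsmul_eq_mul]
      refine le_trans ?_ hb
      gcongr
      refine div_le_self (by positivity) ?_
      linarith [Nat.cast_nonneg (α := ℝ) k]
  refine ⟨∑' y, f y, ?_, ?_⟩
  · have h1 := ((Equiv.ofBijective _ (repeatPath_bijective (r := r))).hasSum_iff).2 hfs.hasSum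
    refine h1.sigma fun x => ?_
    have hp := x.period_pos
    have hz : ‖t ^ x.period‖ < 1 := by
      rw [norm_pow]
      exact pow_lt_one₀ (norm_nonneg _) ht hp.ne'
    -- With p the period, the repetitions of x contribute t^(p(j+1))/(p(j+1)), a Taylor series of
    -- the logarithm divided by p.
    have h2 := (Complex.hasSum_taylorSeries_neg_log' hz).div_const (x.period : ℂ)
    refine Eq.subst (motive := fun g => HasSum g _) (funext fun j => ?_) h2
    symm
    have h3 := repeatPath_fst_add_one ⟨x, j⟩
    have h4 := congrArg (Nat.cast (R := ℂ)) h3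
    push_cast at h4
    simp only [comp_apply, Equiv.ofBijective_apply, hf]
    rw [h3, h4, mul_comm (j + 1), pow_mul, div_div]
  · rw [Matrix.det_one_sub_eq_exp_neg_tsum hc hQt hrow, hfs.tsum_sigma]
    congr 2
    refine tsum_congr fun k => ?_
    have := finite_closedPath (r := r) (k + 1) k.succ_pos
    simp only [hf]
    rw [htr, tsum_const, nsmul_eq_mul, mul_div_assoc]

end Sum

/-! ### Lists as periodic sequences -/

namespace List

variable {α : Type*}

/-- The infinite repetition of a non-empty list. -/
def cyc (C : List α) (h : C ≠ []) (i : ℕ) : α :=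
  C[i % C.length]'(Nat.mod_lt _ (List.length_pos_of_ne_nil h))

lemma cyc_periodic (C : List α) (h : C ≠ []) : Function.Periodic (C.cyc h) C.length := by
  intro i
  simp [cyc]

lemma cyc_of_lt (C : List α) (h : C ≠ []) {i : ℕ} (hi : i < C.length) : C.cyc h i = C[i] := by
  simp [cyc, Nat.mod_eq_of_lt hi]

lemma eq_of_cyc_eq {C D : List α} {hC : C ≠ []} {hD : D ≠ []} (hlen : C.length = D.length)
    (h : C.cyc hC = D.cyc hD) : C = D := by
  refine List.ext_getElem hlen fun i h1 h2 => ?_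
  rw [← C.cyc_of_lt hC h1, ← D.cyc_of_lt hD h2, h]

lemma cyc_rotate (C : List α) (h : C ≠ []) (n : ℕ) (h' : C.rotate n ≠ []) (i : ℕ) :
    (C.rotate n).cyc h' i = C.cyc h (i + n) := by
  simp [cyc, List.getElem_rotate]

lemma cyc_ofFn {p : ℕ} (x : ℕ → α) (hx : Function.Periodic x p)
    (h : List.ofFn (fun i : Fin p => x i) ≠ []) :
    (List.ofFn fun i : Fin p => x i).cyc h = x := by
  funext i
  simp only [cyc, List.getElem_ofFn, List.length_ofFn]
  exact hx.map_mod_nat i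

lemma getElem_flatten_replicate (B : List α) (r i : ℕ) (hB : 0 < B.length)
    (h : i < (List.replicate r B).flatten.length) :
    (List.replicate r B).flatten[i] = B[i % B.length]'(Nat.mod_lt _ hB) := by
  induction r generalizing i with
  | zero => simp at h
  | succ r ih =>
    simp only [List.replicate_succ, List.flatten_cons, List.getElem_append]
    split_ifs with h1
    · simp [Nat.mod_eq_of_lt h1]
    · rw [ih]
      simp only [← Nat.mod_eq_sub_mod (not_lt.1 h1)]

lemma cyc_flatten_replicate (B : List α) (hB : B ≠ []) (r : ℕ)
    (h : (List.replicate r B).flatten ≠ []) :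
    (List.replicate r B).flatten.cyc h = B.cyc hB := by
  funext i
  rw [cyc, getElem_flatten_replicate _ _ _ (List.length_pos_of_ne_nil hB), cyc]
  congr 1
  refine Nat.mod_mod_of_dvd _ ?_
  simp

end List

/-! ### Alternating cycles as periodic paths of states -/

namespace SimpleGraph

open Function

variable {V : Type*} (G : SimpleGraph V)

variable {G} in
/-- The endpoint of an arc that is reached when the arc is traversed along its direction
(`b = true`) or against it (`b = false`). -/
def Dart.target (b : Bool) (e : G.Dart) : V := if b then e.snd else e.fst

variable {G} in
lemma Dart.target_injective (e : G.Dart) : Injective fun b => e.target b := by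
  have h := e.adj.ne
  intro b c hbc
  cases b <;> cases c <;> simp_all [Dart.target]

lemma isAltWalk_cons (b : Bool) (u w : V) (e : G.Dart) (l : List G.Dart) :
    G.IsAltWalk b u w (e :: l) ↔ e.target (!b) = u ∧ G.IsAltWalk (!b) (e.target b) w l := by
  cases b <;> simp [IsAltWalk, Dart.target]

/-- The direction flips at each arc, so arc number i is traversed in direction `b ^^ i.bodd`; this
replaces the recursion by conditions at each index. -/
lemma isAltWalk_iff (b : Bool) (u w : V) (C : List G.Dart) (hC : C ≠ []) :
    G.IsAltWalk b u w C ↔ (C.head hC).target (!b) = u ∧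
      (∀ (i : ℕ) (h : i + 1 < C.length),
        C[i].target (b ^^ i.bodd) = C[i + 1].target (b ^^ i.bodd)) ∧
      (C.getLast hC).target (!(b ^^ C.length.bodd)) = w := by
  induction C generalizing b u with
  | nil => exact absurd rfl hC
  | cons e l ih =>
    rw [isAltWalk_cons]
    cases l with
    | nil => simp [IsAltWalk]
    | cons f l =>
      rw [ih _ _ (List.cons_ne_nil _ _)]
      simp only [List.head_cons, Bool.not_not, List.length_cons, Nat.bodd_succ]
      refine and_congr_right fun _ => ?_
      rw [← and_assoc]
      refine and_congr ?_ ?_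
      · constructor
        · rintro ⟨h1, h2⟩ i hi
          cases i with
          | zero => simpa using h1.symm
          | succ i =>
            have := h2 i (by omega)
            simpa using this
        · intro h
          refine ⟨by simpa using (h 0 (by omega)).symm, fun i hi => ?_⟩
          have h1 := h (i + 1) (Nat.succ_lt_succ hi)
          simp only [List.getElem_cons_succ, Nat.bodd_succ] at h1 ⊢
          simpa using h1
      · simp

/-- An infinite sequence of arcs that is traversed alternately, starting along the direction of the
first arc if `b = true`. -/
def IsAltSeq (b : Bool) (x : ℕ → G.Dart) : Prop :=
  ∀ i, (x i).target (b ^^ i.bodd) = (x (i + 1)).target (b ^^ i.bodd)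

lemma _root_.Nat.bodd_mod_of_bodd_eq_false {k : ℕ} (hk : k.bodd = false) (i : ℕ) :
    (i % k).bodd = i.bodd := by
  conv_rhs => rw [← Nat.mod_add_div i k]
  simp [hk]

lemma isAltCycle_iff (C : List G.Dart) :
    G.IsAltCycle C ↔ ∃ h : C ≠ [], C.length.bodd = false ∧ ∃ b, G.IsAltSeq b (C.cyc h) := by
  have hcond : ∀ (h : C ≠ []) (v : V),
      (((C.head h).fst = v ∧ (C.getLast h).fst = v) ∨
        ((C.head h).snd = v ∧ (C.getLast h).snd = v)) ↔
      ∃ c, (C.head h).target c = v ∧ (C.getLast h).target c = v := by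
    intro h v
    simp [Dart.target]
  constructor
  · rintro ⟨h, b, v, hw, hc⟩
    obtain ⟨c, hc1, hc2⟩ := (hcond h v).1 hc
    obtain ⟨hw1, hw2, hw3⟩ := (G.isAltWalk_iff b v v C h).1 hw
    have e1 : c = !b := (C.head h).target_injective (hc1.trans hw1.symm)
    -- The first and the last arc meet v with the same kind of endpoint, which forces the length to
    -- be even.
    have e2 : c = !(b ^^ C.length.bodd) := (C.getLast h).target_injective (hc2.trans hw3.symm)
    have hk : C.length.bodd = false := by
      rw [e1] at e2
      revert e2
      cases b <;> cases C.length.bodd <;> simp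
    refine ⟨h, hk, b, fun i => ?_⟩
    have hpos := List.length_pos_of_ne_nil h
    have hi := Nat.mod_lt i hpos
    rcases Nat.lt_or_ge (i % C.length + 1) C.length with h1 | h1
    · have := hw2 (i % C.length) h1
      rw [Nat.bodd_mod_of_bodd_eq_false hk] at this
      have h2 : (i + 1) % C.length = i % C.length + 1 := by
        rw [← Nat.mod_add_mod, Nat.mod_eq_of_lt h1]
      simpa only [List.cyc, h2] using this
    · have h2 : i % C.length = C.length - 1 := by omega
      have h3 : (i + 1) % C.length = 0 := by
        rw [← Nat.mod_add_mod, show i % C.length + 1 = C.length by omega, Nat.mod_self]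
      have h4 : (b ^^ i.bodd) = !b := by
        rw [← Nat.bodd_mod_of_bodd_eq_false hk i]
        have h5 : (i % C.length + 1).bodd = false := by
          rw [show i % C.length + 1 = C.length by omega, hk]
        rw [Nat.bodd_succ] at h5
        cases b <;> simp_all
      simp only [List.cyc, h2, h3, h4]
      rw [← List.getLast_eq_getElem h, ← List.head_eq_getElem h, hw1, ← e1, hc2]
  · rintro ⟨h, hk, b, hx⟩
    have hpos := List.length_pos_of_ne_nil h
    have hlast : (C.getLast h).target (!b) = (C.head h).target (!b) := by
      have := hx (C.length - 1)
      have h5 : (C.length - 1 + 1).bodd = false := by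
        rw [Nat.sub_add_cancel hpos, hk]
      rw [Nat.bodd_succ] at h5
      have h6 : (C.length - 1).bodd = true := by simpa using h5
      rw [h6, Nat.sub_add_cancel hpos] at this
      simp only [List.cyc, Nat.mod_self, Nat.mod_eq_of_lt (Nat.sub_lt hpos one_pos)] at this
      rw [← List.getLast_eq_getElem h, ← List.head_eq_getElem h] at this
      simpa using this
    refine ⟨h, b, (C.head h).target (!b), ?_, (hcond h _).2 ⟨!b, rfl, hlast⟩⟩
    rw [isAltWalk_iff _ _ _ _ _ h]
    refine ⟨rfl, fun i hi => ?_, ?_⟩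
    · have := hx i
      rwa [C.cyc_of_lt h hi, C.cyc_of_lt h (by omega)] at this
    · rw [hk]
      simpa using hlast

/-- One step of a reduced alternating walk, where a state is an arc together with the way it is
traversed. -/
def AltStep (a b : Bool × G.Dart) : Prop :=
  b.1 = !a.1 ∧ a.2 ≠ b.2 ∧ a.2.target a.1 = b.2.target a.1

variable {G} in
/-- The sequence of states of an alternating sequence of arcs. -/
def altStates (b : Bool) (x : ℕ → G.Dart) (i : ℕ) : Bool × G.Dart := (b ^^ i.bodd, x i)

lemma altStep_altStates_iff (b : Bool) (x : ℕ → G.Dart) :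
    (∀ i, G.AltStep (altStates b x i) (altStates b x (i + 1))) ↔
      G.IsAltSeq b x ∧ ∀ i, x i ≠ x (i + 1) := by
  simp only [AltStep, altStates, IsAltSeq, Nat.bodd_succ]
  constructor
  · intro h
    exact ⟨fun i => (h i).2.2, fun i => (h i).2.1⟩
  · rintro ⟨h1, h2⟩ i
    refine ⟨?_, h2 i, h1 i⟩
    cases b <;> simp

lemma eq_altStates (x : ℕ → Bool × G.Dart) (hx : ∀ i, G.AltStep (x i) (x (i + 1))) :
    x = altStates (x 0).1 fun i => (x i).2 := by
  funext i
  refine Prod.ext ?_ rfl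
  simp only [altStates]
  induction i with
  | zero => simp
  | succ i ih =>
    rw [(hx i).1, ih, Nat.bodd_succ]
    cases (x 0).1 <;> simp

/-- If both phases were possible, the first two arcs would share origin and terminus and thus be
equal, contrary to reducedness. -/
lemma altStates_phase_unique {b c : Bool} {x : ℕ → G.Dart}
    (hb : ∀ i, G.AltStep (altStates b x i) (altStates b x (i + 1)))
    (hc : ∀ i, G.AltStep (altStates c x i) (altStates c x (i + 1))) : b = c := by
  rw [altStep_altStates_iff] at hb hc
  by_contra hbc
  have h1 := hb.1 0
  have h2 := hc.1 0
  refine hb.2 0 (Dart.ext _ _ ?_)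
  cases b <;> cases c <;> simp_all [Dart.target, Prod.ext_iff]

lemma isPeriodicPt_altStates_iff (b : Bool) (x : ℕ → G.Dart) (k : ℕ) :
    IsPeriodicPt seqShift k (altStates b x) ↔ k.bodd = false ∧ Function.Periodic x k := by
  rw [isPeriodicPt_seqShift_iff]
  constructor
  · intro h
    refine ⟨?_, fun i => congrArg Prod.snd (h i)⟩
    have := congrArg Prod.fst (h 0)
    revert this
    simp only [altStates, zero_add]
    cases b <;> cases k.bodd <;> simp
  · rintro ⟨h1, h2⟩ i
    simp only [altStates, h2 i, Nat.bodd_add, h1, Bool.xor_false]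

lemma isReducedAltCycle_iff (C : List G.Dart) :
    G.IsReducedAltCycle C ↔ ∃ h : C ≠ [], C.length.bodd = false ∧
      ∃ b, ∀ i, G.AltStep (altStates b (C.cyc h) i) (altStates b (C.cyc h) (i + 1)) := by
  have hkey : ∀ h : C ≠ [], (∀ i, C.cyc h i ≠ C.cyc h (i + 1)) ↔
      (C.IsChain (· ≠ ·) ∧ C.getLast? ≠ C.head?) := by
    intro h
    have hpos := List.length_pos_of_ne_nil h
    rw [List.getLast?_eq_some_getLast h, List.head?_eq_some_head h, List.isChain_iff_getElem,
      List.getLast_eq_getElem h, List.head_eq_getElem h]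
    constructor
    · intro hx
      refine ⟨fun i hi => ?_, ?_⟩
      · have := hx i
        rwa [C.cyc_of_lt h hi, C.cyc_of_lt h (by omega)] at this
      · have := hx (C.length - 1)
        rw [Nat.sub_add_cancel hpos] at this
        simp only [List.cyc, Nat.mod_self, Nat.mod_eq_of_lt (Nat.sub_lt hpos one_pos)] at this
        simpa using this
    · rintro ⟨h1, h2⟩ i
      have hi := Nat.mod_lt i hpos
      rcases Nat.lt_or_ge (i % C.length + 1) C.length with h3 | h3
      · have h4 : (i + 1) % C.length = i % C.length + 1 := by
          rw [← Nat.mod_add_mod, Nat.mod_eq_of_lt h3]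
        simpa only [List.cyc, h4] using h1 _ h3
      · have h4 : i % C.length = C.length - 1 := by omega
        have h5 : (i + 1) % C.length = 0 := by
          rw [← Nat.mod_add_mod, show i % C.length + 1 = C.length by omega, Nat.mod_self]
        simp only [List.cyc, h4, h5]
        simpa using h2
  simp only [altStep_altStates_iff]
  rw [IsReducedAltCycle, isAltCycle_iff]
  constructor
  · rintro ⟨⟨h, hk, b, hx⟩, h2⟩
    exact ⟨h, hk, b, hx, (hkey h).2 h2⟩
  · rintro ⟨h, hk, b, hx, h2⟩
    exact ⟨⟨h, hk, b, hx⟩, (hkey h).1 h2⟩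

/-- A reduced alternating cycle is prime if and only if its length is the minimal period of the
corresponding sequence of states. -/
lemma isPrime_and_isReduced_iff (C : List G.Dart) :
    (G.IsPrimeAltCycle C ∧ G.IsReducedAltCycle C) ↔ ∃ h : C ≠ [], ∃ b,
      (∀ i, G.AltStep (altStates b (C.cyc h) i) (altStates b (C.cyc h) (i + 1))) ∧
        minimalPeriod seqShift (altStates b (C.cyc h)) = C.length := by
  rw [isReducedAltCycle_iff]
  constructor
  · rintro ⟨⟨-, hC⟩, h, hk, b, hx⟩
    refine ⟨h, b, hx, ?_⟩
    have hpos := List.length_pos_of_ne_nil h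
    have hper : IsPeriodicPt seqShift C.length (altStates b (C.cyc h)) :=
      (G.isPeriodicPt_altStates_iff b _ _).2 ⟨hk, C.cyc_periodic h⟩
    set p := minimalPeriod seqShift (altStates b (C.cyc h)) with hp
    have hp0 : 0 < p := hper.minimalPeriod_pos hpos
    have hpp : IsPeriodicPt seqShift p (altStates b (C.cyc h)) := isPeriodicPt_minimalPeriod _ _
    obtain ⟨hp1, hp2⟩ := (G.isPeriodicPt_altStates_iff b _ _).1 hpp
    by_contra hne
    have hlt : p < C.length := lt_of_le_of_ne (hper.minimalPeriod_le hpos) hne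
    obtain ⟨r, hr⟩ := hper.minimalPeriod_dvd
    have hB : (List.ofFn fun i : Fin p => C.cyc h i) ≠ [] := by
      rw [Ne, List.ofFn_eq_nil_iff]; exact hp0.ne'
    have hcyc := List.cyc_ofFn (C.cyc h) hp2 hB
    -- A smaller minimal period p is even, so the first p arcs form a shorter alternating cycle of
    -- which C is a multiple.
    refine hC ⟨List.ofFn fun i : Fin p => C.cyc h i, r, ?_, by simpa using hlt, ?_⟩
    · rw [isAltCycle_iff]
      refine ⟨hB, by simpa using hp1, b, ?_⟩
      rw [hcyc]
      exact ((G.altStep_altStates_iff b _).1 hx).1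
    · have hlen : C.length =
          (List.replicate r (List.ofFn fun i : Fin p => C.cyc h i)).flatten.length := by
        rw [hr]; simp [hp, mul_comm]
      have hne' : (List.replicate r (List.ofFn fun i : Fin p => C.cyc h i)).flatten ≠ [] := by
        rw [← List.length_pos_iff_ne_nil, ← hlen]; exact hpos
      refine List.eq_of_cyc_eq (hC := h) (hD := hne') hlen ?_
      rw [List.cyc_flatten_replicate _ hB, hcyc]
  · rintro ⟨h, b, hx, hp⟩
    have hpos := List.length_pos_of_ne_nil h
    have hpp : IsPeriodicPt seqShift C.length (altStates b (C.cyc h)) :=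
      hp ▸ isPeriodicPt_minimalPeriod _ _
    have hk := ((G.isPeriodicPt_altStates_iff b _ _).1 hpp).1
    refine ⟨⟨(G.isAltCycle_iff C).2 ⟨h, hk, b, ((G.altStep_altStates_iff b _).1 hx).1⟩, ?_⟩,
      h, hk, b, hx⟩
    rintro ⟨B, r, hB, hlt, hCB⟩
    -- Only the parity of the length of B is needed; its phase need not be compared with b.
    obtain ⟨hB0, hBk, -⟩ := (G.isAltCycle_iff B).1 hB
    have hcyc : C.cyc h = B.cyc hB0 := by
      subst hCB
      exact List.cyc_flatten_replicate B hB0 r h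
    have hBp : IsPeriodicPt seqShift B.length (altStates b (C.cyc h)) :=
      (G.isPeriodicPt_altStates_iff b _ _).2 ⟨hBk, hcyc ▸ B.cyc_periodic hB0⟩
    have := hBp.minimalPeriod_le (List.length_pos_of_ne_nil hB0)
    omega

variable {G}

/-! ### Cycles, their rotations and their classes -/

namespace PrimeReducedAltCycle

lemma ne_nil (C : G.PrimeReducedAltCycle) : C.1 ≠ [] :=
  ((G.isPrime_and_isReduced_iff C.1).1 C.2).1

/-- Whether the first arc of the cycle is traversed along its direction. -/
noncomputable def phase (C : G.PrimeReducedAltCycle) : Bool :=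
  ((G.isPrime_and_isReduced_iff C.1).1 C.2).2.choose

lemma altStep_phase (C : G.PrimeReducedAltCycle) (i : ℕ) :
    G.AltStep (altStates C.phase (C.1.cyc C.ne_nil) i)
      (altStates C.phase (C.1.cyc C.ne_nil) (i + 1)) :=
  ((G.isPrime_and_isReduced_iff C.1).1 C.2).2.choose_spec.1 i

lemma minimalPeriod_altStates (C : G.PrimeReducedAltCycle) :
    minimalPeriod seqShift (altStates C.phase (C.1.cyc C.ne_nil)) = C.1.length :=
  ((G.isPrime_and_isReduced_iff C.1).1 C.2).2.choose_spec.2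

lemma length_pos (C : G.PrimeReducedAltCycle) : 0 < C.1.length :=
  List.length_pos_of_ne_nil C.ne_nil

lemma altStates_mem_periodicPts (C : G.PrimeReducedAltCycle) :
    altStates C.phase (C.1.cyc C.ne_nil) ∈ periodicPts seqShift := by
  rw [← minimalPeriod_pos_iff_mem_periodicPts, C.minimalPeriod_altStates]
  exact C.length_pos

/-- The periodic path of states that belongs to a cycle. -/
noncomputable def toPath (C : G.PrimeReducedAltCycle) : PeriodicPath G.AltStep :=
  ⟨altStates C.phase (C.1.cyc C.ne_nil), C.altStep_phase, C.altStates_mem_periodicPts⟩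

lemma period_toPath (C : G.PrimeReducedAltCycle) : C.toPath.period = C.1.length :=
  C.minimalPeriod_altStates

lemma toPath_bijective : Bijective (toPath (G := G)) := by
  constructor
  · intro C D h
    have hlen : C.1.length = D.1.length := by rw [← period_toPath, h, period_toPath]
    refine Subtype.ext (List.eq_of_cyc_eq (hC := C.ne_nil) (hD := D.ne_nil) hlen ?_)
    funext i
    exact congrArg Prod.snd (congrFun (congrArg Subtype.val h) i)
  · intro x
    have hp := x.period_pos
    have hx := G.eq_altStates x.1 x.2.1
    have hper : IsPeriodicPt seqShift x.period x.1 := isPeriodicPt_minimalPeriod _ _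
    rw [hx] at hper
    have hper2 := ((G.isPeriodicPt_altStates_iff _ _ _).1 hper).2
    set C : List G.Dart := List.ofFn fun i : Fin x.period => (x.1 i).2 with hC
    have hne : C ≠ [] := by
      rw [hC, Ne, List.ofFn_eq_nil_iff]; exact hp.ne'
    have hcyc : C.cyc hne = fun i => (x.1 i).2 := List.cyc_ofFn _ hper2 hne
    have hstep : ∀ i, G.AltStep (altStates (x.1 0).1 (C.cyc hne) i)
        (altStates (x.1 0).1 (C.cyc hne) (i + 1)) := by
      rw [hcyc, ← hx]
      exact x.2.1
    have hlen : C.length = x.period := by simp [hC]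
    let D : G.PrimeReducedAltCycle := ⟨C, (G.isPrime_and_isReduced_iff C).2
      ⟨hne, (x.1 0).1, hstep, by rw [hcyc, ← hx, hlen]; rfl⟩⟩
    refine ⟨D, Subtype.ext ?_⟩
    have hphase : D.phase = (x.1 0).1 := G.altStates_phase_unique D.altStep_phase hstep
    show altStates D.phase (C.cyc hne) = x.1
    rw [hphase, hcyc, ← hx]

lemma altStates_rotate (C : G.PrimeReducedAltCycle) (n : ℕ) (h : C.1.rotate n ≠ []) :
    altStates (C.phase ^^ n.bodd) ((C.1.rotate n).cyc h) =
      seqShift^[n] (altStates C.phase (C.1.cyc C.ne_nil)) := by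
  funext i
  rw [seqShift_iterate_apply]
  simp only [altStates, List.cyc_rotate _ C.ne_nil, Nat.bodd_add]
  congr 1
  cases C.phase <;> cases n.bodd <;> cases i.bodd <;> rfl

/-- The cyclic rotation of a cycle. -/
def rotate (C : G.PrimeReducedAltCycle) (n : ℕ) : G.PrimeReducedAltCycle :=
  ⟨C.1.rotate n, by
    have h : C.1.rotate n ≠ [] := by simpa using C.ne_nil
    refine (G.isPrime_and_isReduced_iff _).2 ⟨h, C.phase ^^ n.bodd, fun i => ?_, ?_⟩
    · rw [C.altStates_rotate n h, seqShift_iterate_apply, seqShift_iterate_apply,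
        add_right_comm]
      exact C.altStep_phase _
    · rw [C.altStates_rotate n h, minimalPeriod_apply_iterate C.altStates_mem_periodicPts,
        C.minimalPeriod_altStates, List.length_rotate]⟩

lemma toPath_rotate (C : G.PrimeReducedAltCycle) (n : ℕ) :
    (C.rotate n).toPath.1 = seqShift^[n] C.toPath.1 := by
  have h : C.1.rotate n ≠ [] := (C.rotate n).ne_nil
  have h1 := C.altStates_rotate n h
  have h2 : (C.rotate n).phase = (C.phase ^^ n.bodd) := by
    refine G.altStates_phase_unique (C.rotate n).altStep_phase fun i => ?_
    show G.AltStep (altStates _ ((C.1.rotate n).cyc h) i) (altStates _ ((C.1.rotate n).cyc h) _)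
    rw [h1, seqShift_iterate_apply, seqShift_iterate_apply, add_right_comm]
    exact C.altStep_phase _
  show altStates (C.rotate n).phase ((C.1.rotate n).cyc h) = _
  rw [h2, h1]
  rfl

lemma rotate_injOn (C : G.PrimeReducedAltCycle) {i j : ℕ} (hi : i < C.1.length)
    (hj : j < C.1.length) (h : C.rotate i = C.rotate j) : i = j := by
  have h1 := congrArg (fun D : G.PrimeReducedAltCycle => D.toPath.1) h
  simp only [toPath_rotate] at h1
  have hp := C.minimalPeriod_altStates
  exact iterate_injOn_Iio_minimalPeriod (f := seqShift) (x := C.toPath.1)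
    (by rw [Set.mem_Iio]; exact hi.trans_eq hp.symm)
    (by rw [Set.mem_Iio]; exact hj.trans_eq hp.symm) h1

end PrimeReducedAltCycle

/-- The class of a cycle. -/
def AltCycleClass.mk (C : G.PrimeReducedAltCycle) : G.AltCycleClass :=
  Quotient.mk G.altCycleSetoid C

namespace AltCycleClass

lemma length_mk (C : G.PrimeReducedAltCycle) : (mk C).length = C.1.length := rfl

lemma length_pos (c : G.AltCycleClass) : 0 < c.length := by
  induction c using Quotient.inductionOn with
  | h C => exact C.length_pos

lemma mk_eq_mk_iff (C D : G.PrimeReducedAltCycle) : mk C = mk D ↔ C.1 ~r D.1 :=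
  Quotient.eq (r := G.altCycleSetoid)

/-- The length is the minimal period of the state sequence, so the rotations by 0, …, |C| - 1 are
distinct and exhaust the class. -/
lemma finite_fiber_and_card (c : G.AltCycleClass) :
    Finite {C : G.PrimeReducedAltCycle // mk C = c} ∧
      Nat.card {C : G.PrimeReducedAltCycle // mk C = c} = c.length := by
  obtain ⟨C, rfl⟩ : ∃ C, mk C = c := Quotient.exists_rep c
  let φ : Fin C.1.length → {D : G.PrimeReducedAltCycle // mk D = mk C} := fun i =>
    ⟨C.rotate i, (mk_eq_mk_iff _ _).2 (List.IsRotated.symm ⟨i, rfl⟩)⟩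
  have hφ : Bijective φ := by
    constructor
    · intro i j h
      exact Fin.ext (C.rotate_injOn i.2 j.2 (congrArg Subtype.val h))
    · rintro ⟨D, hD⟩
      obtain ⟨n, hn⟩ := ((mk_eq_mk_iff _ _).1 hD).symm
      refine ⟨⟨n % C.1.length, Nat.mod_lt _ C.length_pos⟩, Subtype.ext (Subtype.ext ?_)⟩
      show C.1.rotate (n % C.1.length) = D.1
      rw [List.rotate_mod, hn]
  refine ⟨Finite.of_surjective φ hφ.2, ?_⟩
  rw [← Nat.card_congr (Equiv.ofBijective φ hφ), Nat.card_fin, length_mk]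

end AltCycleClass

end SimpleGraph

/-! ### The Euler product and the final formulas -/

namespace SimpleGraph

open Matrix

variable {V : Type*} [Fintype V] (G : SimpleGraph V)

lemma smul_transitionMatrix [DecidableRel G.Adj] (d : ℂ) (hd : ∀ v, (G.degree v : ℂ) = d) :
    d • G.transitionMatrix = G.adjMatrix ℂ := by
  ext u v
  simp only [transitionMatrix, Matrix.smul_apply, of_apply, smul_eq_mul, adjMatrix_apply]
  split_ifs with h
  · have h0 : G.degree u ≠ 0 := ((G.degree_pos_iff_exists_adj u).2 ⟨v, h⟩).ne'
    have h1 : (G.degree u : ℂ) ≠ 0 := by exact_mod_cast h0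
    rw [hd u] at h1 ⊢
    rw [mul_one_div_cancel h1]
  · simp

variable [DecidableEq V]

instance decidableRelAltStep : DecidableRel G.AltStep := fun a b => by
  unfold AltStep
  infer_instance

/-- A state as an element of the index set of the block matrix. -/
def altStateEquiv : Bool × G.Dart ≃ G.Dart ⊕ G.Dart :=
  (Equiv.boolProdEquivSum G.Dart).trans (Equiv.sumComm _ _)

/-- The identity subtracted in each block removes the backtracking step; `altStateEquiv` lists the
states traversed along their direction first. -/
lemma relMatrix_altStep_eq :
    relMatrix G.AltStep = G.altBlockMatrix.submatrix G.altStateEquiv G.altStateEquiv := by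
  have h1 : ∀ e f : G.Dart, (G.terminusMatrix * G.terminusMatrixᵀ) e f =
      if e.snd = f.snd then 1 else 0 := by
    intro e f
    simp [mul_apply, terminusMatrix, eq_comm]
  have h2 : ∀ e f : G.Dart, (G.originMatrix * G.originMatrixᵀ) e f =
      if e.fst = f.fst then 1 else 0 := by
    intro e f
    simp [mul_apply, originMatrix, eq_comm]
  ext ⟨b, e⟩ ⟨c, f⟩
  by_cases hef : e = f
  · subst hef
    cases b <;> cases c <;>
      simp [relMatrix, AltStep, altBlockMatrix, altStateEquiv, Equiv.boolProdEquivSum, h1, h2]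
  · cases b <;> cases c <;>
      simp [relMatrix, AltStep, altBlockMatrix, altStateEquiv, Equiv.boolProdEquivSum, h1, h2,
        hef, Dart.target]

variable [DecidableRel G.Adj]

lemma card_dart_target_eq (b : Bool) (v : V) :
    (Finset.univ.filter fun e : G.Dart => e.target b = v).card = G.degree v := by
  cases b
  · simpa [Dart.target] using G.dart_fst_fiber_card_eq_degree v
  · simpa [Dart.target] using G.card_dart_snd_eq v

lemma card_filter_altStep_add_one (a : Bool × G.Dart) :
    (Finset.univ.filter (G.AltStep a)).card + 1 = G.degree (a.2.target a.1) := by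
  rw [← G.card_dart_target_eq a.1, ← Finset.card_erase_add_one (a := a.2) (by simp)]
  congr 1
  refine Finset.card_bij' (fun c _ => c.2) (fun e _ => (!a.1, e)) ?_ ?_ ?_ ?_
  · intro c hc
    simp only [Finset.mem_filter, Finset.mem_univ, true_and, AltStep] at hc
    simp [hc.2.1.symm, hc.2.2]
  · intro e he
    simp only [Finset.mem_erase, Finset.mem_filter, Finset.mem_univ, true_and] at he
    simp [AltStep, he.1.symm, he.2]
  · intro c hc
    simp only [Finset.mem_filter, Finset.mem_univ, true_and, AltStep] at hc
    exact Prod.ext hc.1.symm rfl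
  · intro e _
    rfl

lemma det_one_sub_smul_relMatrix_altStep (t : ℂ) :
    (1 - t • relMatrix G.AltStep).det = (1 - t • G.altBlockMatrix).det := by
  rw [← det_submatrix_equiv_self G.altStateEquiv (1 - t • G.altBlockMatrix),
    relMatrix_altStep_eq]
  congr 1
  rw [← submatrix_one_equiv G.altStateEquiv]
  rfl

/-- The Euler product of the alternating zeta function converges to the inverse of the determinant
of the transfer matrix. -/
theorem exists_hasProd_altZeta (Q : ℕ) (hQ : ∀ v, G.degree v ≤ Q + 1) (t : ℂ) (ht : ‖t‖ < 1)
    (hQt : (Q : ℝ) * ‖t‖ < 1) :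
    ∃ L : ℂ, HasProd (fun c : G.AltCycleClass => (1 - t ^ c.length)⁻¹) (Complex.exp L) ∧
      Complex.exp (-L) = (1 - t • G.altBlockMatrix).det := by
  obtain ⟨L, hL, hdet⟩ := exists_hasSum_neg_log_periodicPath (r := G.AltStep) Q
    (fun a => by
      have := G.card_filter_altStep_add_one a
      have := hQ (a.2.target a.1)
      omega) t ht hQt
  refine ⟨L, ?_, by rw [hdet, det_one_sub_smul_relMatrix_altStep]⟩
  have h1 := (Equiv.ofBijective _ (PrimeReducedAltCycle.toPath_bijective (G := G))).hasSum_iff.2 hL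
  have h2 := (Equiv.sigmaFiberEquiv (AltCycleClass.mk (G := G))).hasSum_iff.2 h1
  -- The ℓ cycles of a class of length ℓ contribute equal terms, which cancels the denominator ℓ.
  have h3 : HasSum (fun c : G.AltCycleClass => -Complex.log (1 - t ^ c.length)) L := by
    refine h2.sigma fun c => ?_
    obtain ⟨hfin, hcard⟩ := c.finite_fiber_and_card
    have hconst : ∀ C : {C : G.PrimeReducedAltCycle // AltCycleClass.mk C = c},
        C.1.toPath.period = c.length := by
      rintro ⟨C, rfl⟩
      exact C.period_toPath
    have := Fintype.ofFinite {C : G.PrimeReducedAltCycle // AltCycleClass.mk C = c}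
    have hs := hasSum_fintype fun _ : {C : G.PrimeReducedAltCycle // AltCycleClass.mk C = c} =>
      -Complex.log (1 - t ^ c.length) / c.length
    rw [Finset.sum_const, Finset.card_univ, ← Nat.card_eq_fintype_card, hcard, nsmul_eq_mul,
      mul_div_cancel₀ _ (by exact_mod_cast c.length_pos.ne')] at hs
    refine Eq.subst (motive := fun g => HasSum g _) (funext fun C => ?_) hs
    show _ = -Complex.log (1 - t ^ C.1.toPath.period) / C.1.toPath.period
    rw [hconst C]
  have h4 := h3.cexp
  refine Eq.subst (motive := fun g => HasProd g _) (funext fun c => ?_) h4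
  have hne : 1 - t ^ c.length ≠ 0 := by
    intro h
    have h5 : ‖t ^ c.length‖ < 1 := by
      rw [norm_pow]
      exact pow_lt_one₀ (norm_nonneg _) ht c.length_pos.ne'
    rw [← sub_eq_zero.1 h, norm_one] at h5
    exact lt_irrefl _ h5
  simp only [Function.comp_apply]
  rw [Complex.exp_neg, Complex.exp_log hne]

lemma lapMatrix_eq_smul_one_sub (d : ℂ) (hd : ∀ v, (G.degree v : ℂ) = d) :
    G.lapMatrix ℂ = d • 1 - G.adjMatrix ℂ := by
  rw [lapMatrix, degMatrix]
  congr 1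
  ext u v
  by_cases h : u = v
  · subst h; simp [hd]
  · simp [h]

end SimpleGraph

theorem proposition2 {V : Type*} [Fintype V] [DecidableEq V] (G : SimpleGraph V)
    [DecidableRel G.Adj] (hconn : G.Connected) (q : ℤ)
    (hreg : ∀ v : V, (G.degree v : ℤ) = q + 1) (n m : ℕ) (hn : n = Fintype.card V)
    (hm : m = G.edgeFinset.card) (t : ℂ) (ht : ‖t‖ < 1) (hqt : (q : ℝ) * ‖t‖ < 1) :
    Multipliable (fun c : G.AltCycleClass => (1 - t ^ c.length)⁻¹) ∧
    G.altZeta t ≠ 0 ∧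
    (G.altZeta t)⁻¹ =
      (1 - t ^ 2) ^ (2 * ((m : ℤ) - (n : ℤ))) *
        ((1 + (q : ℂ) * t ^ 2) • (1 : Matrix V V ℂ) -
          (((q : ℂ) + 1) * t) • G.transitionMatrix).det *
        ((1 + (q : ℂ) * t ^ 2) • (1 : Matrix V V ℂ) +
          (((q : ℂ) + 1) * t) • G.transitionMatrix).det ∧
    (G.altZeta t)⁻¹ =
      (1 - t ^ 2) ^ (2 * ((m : ℤ) - (n : ℤ))) *
        ((1 - ((q : ℂ) + 1) * t + (q : ℂ) * t ^ 2) • (1 : Matrix V V ℂ) +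
          t • G.lapMatrix ℂ).det *
        ((1 + ((q : ℂ) + 1) * t + (q : ℂ) * t ^ 2) • (1 : Matrix V V ℂ) -
          t • G.lapMatrix ℂ).det := by
  have hdeg : ∀ v, (G.degree v : ℂ) = (q : ℂ) + 1 := fun v => by exact_mod_cast hreg v
  -- For a single vertex q = -1, and truncation to 0 still bounds the number of successors.
  have hQt : ((q.toNat : ℕ) : ℝ) * ‖t‖ < 1 := by
    rcases le_total 0 q with h | h
    · have : ((q.toNat : ℕ) : ℝ) = (q : ℝ) := by exact_mod_cast Int.toNat_of_nonneg h
      rwa [this]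
    · simp [Int.toNat_of_nonpos h]
  have ht2 : 1 - t ^ 2 ≠ 0 := by
    intro h
    have h5 : ‖t ^ 2‖ < 1 := by
      rw [norm_pow]
      exact pow_lt_one₀ (norm_nonneg _) ht two_ne_zero
    rw [← sub_eq_zero.1 h, norm_one] at h5
    exact lt_irrefl _ h5
  obtain ⟨L, hL, hdet⟩ := G.exists_hasProd_altZeta q.toNat
    (fun v => by have := hreg v; omega) t ht hQt
  have hz : G.altZeta t = Complex.exp L := hL.tprod_eq
  have hmain : (G.altZeta t)⁻¹ = (1 - t ^ 2) ^ (2 * ((m : ℤ) - (n : ℤ))) *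
      ((1 + (q : ℂ) * t ^ 2) • (1 : Matrix V V ℂ) - t • G.adjMatrix ℂ).det *
      ((1 + (q : ℂ) * t ^ 2) • (1 : Matrix V V ℂ) + t • G.adjMatrix ℂ).det := by
    have hB := G.det_one_sub_smul_altBlockMatrix (q : ℂ) t hdeg ht2
    rw [G.dart_card_eq_twice_card_edges, ← hn, ← hm] at hB
    -- The exponent 2(m - n) is negative for trees, so the power is split as a quotient and the
    -- denominator cleared.
    rw [hz, ← Complex.exp_neg, hdet, mul_sub, zpow_sub₀ ht2, mul_assoc, div_mul_eq_mul_div,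
      eq_div_iff (zpow_ne_zero _ ht2)]
    exact_mod_cast hB
  have hP := G.smul_transitionMatrix _ hdeg
  have hLap := G.lapMatrix_eq_smul_one_sub _ hdeg
  refine ⟨hL.multipliable, by rw [hz]; exact Complex.exp_ne_zero _, ?_, ?_⟩
  · rw [hmain, mul_comm ((q : ℂ) + 1) t, ← smul_smul, hP]
  · rw [hmain, hLap]
    congr 2
    · congr 2
      module
    · module
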